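/- Let $U(L(sl_2))$ be the universal enveloping algebra of the loop algebra $\mathbb{C}[t,t^{-1}]\otimes sl_2(\mathbb{C})$, with generators $x_k^{+}=t^k\otimes E_{12}$, $x_k^{-}=t^k\otimes E_{21}$, $h_k=t^k\otimes(E_{11}-E_{22})$ $(k\in\mathbb{Z})$, so that $[h_j,x_k^{\pm}]=\pm2x_{j+k}^{\pm}$, $[x_j^{+},x_k^{-}]=h_{j+k}$, $[h_j,h_k]=[x_j^{\pm},x_k^{\pm}]=0$. Let the Borel subalgebra $U(B)\subset U(L(sl_2))$ be the unital subalgebra generated by $h_0$, $x_0^{+}$, $x_1^{-}$; it contains $h_k$, $x_k^{+}$ for $k\ge 0$ and $x_k^{-}$ for $k\ge 1$. Let $V_B$ be a finite-dimensional complex representation of $U(B)$ generated by a highest weight vector $\Psi$, that is, $V_B=U(B)\Psi$ with $\Psi\neq0$ and there are $d_k\in\mathbb{C}$ such that $x_k^{+}\Psi=0$ and $h_k\Psi=d_k\Psi$ for all $k\ge0$. Suppose that $x_1^{-}$ is nilpotent of degree $r\geq 0$ in $V_B$, that is, $(x_1^{-})^{r+1}\Psi=0$ while $(x_1^{-})^{j}\Psi\ne0$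 for $0<j\le r$. For $k\ge0$ let $\lambda_k\in\mathbb{C}$ be the eigenvalue given by $$\frac{(x_0^{+})^{k}}{k!}\,\frac{(x_1^{-})^{k}}{k!}\,\Psi=\lambda_k\Psi$$ ($\Psi$ is always an eigenvector of this operator), and let $P_\Psi(u)=\sum_{k=0}^{r}\lambda_k(-u)^k$ be the generalized Drinfeld polynomial of $\Psi$. Suppose that $\Psi$ has distinct and nonzero evaluation parameters $a_1,\dots,a_r\in\mathbb{C}$, that is, $$P_\Psi(u)=\prod_{j=1}^{r}(1-a_ju)$$ with $a_1,\dots,a_r$ pairwise distinct and all nonzero. Then $V_B$ is irreducible. -/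

import Mathlib

open scoped TensorProduct

namespace SlTwoLoop

/-- The `sl₂` loop algebra `ℂ[t, t⁻¹] ⊗ sl₂(ℂ)`. -/
abbrev Loop : Type :=
  LieAlgebra.loopAlgebra ℂ ℤ (LieAlgebra.SpecialLinear.sl (Fin 2) ℂ)

/-- The universal enveloping algebra `U(L(sl₂))`. -/
abbrev ULoop : Type := UniversalEnvelopingAlgebra ℂ Loop

/-- The loop algebra element `t ^ k ⊗ E₁₂`. -/
noncomputable def loopXPlus (k : ℤ) : Loop :=
  (LaurentPolynomial.T k : LaurentPolynomial ℂ) ⊗ₜ[ℂ]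
    LieAlgebra.SpecialLinear.single (0 : Fin 2) 1 (by decide) (1 : ℂ)

/-- The loop algebra element `t ^ k ⊗ E₂₁`. -/
noncomputable def loopXMinus (k : ℤ) : Loop :=
  (LaurentPolynomial.T k : LaurentPolynomial ℂ) ⊗ₜ[ℂ]
    LieAlgebra.SpecialLinear.single (1 : Fin 2) 0 (by decide) (1 : ℂ)

/-- The loop algebra element `t ^ k ⊗ (E₁₁ - E₂₂)`. -/
noncomputable def loopH (k : ℤ) : Loop :=
  (LaurentPolynomial.T k : LaurentPolynomial ℂ) ⊗ₜ[ℂ]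
    LieAlgebra.SpecialLinear.singleSubSingle (0 : Fin 2) 1 (1 : ℂ)

/-! The defining relations of the Drinfeld generators hold in the loop algebra. -/

theorem loop_lie_tmul (j k : ℤ) (a b : LieAlgebra.SpecialLinear.sl (Fin 2) ℂ) :
    ⁅((LaurentPolynomial.T j : LaurentPolynomial ℂ) ⊗ₜ[ℂ] a : Loop),
      ((LaurentPolynomial.T k : LaurentPolynomial ℂ) ⊗ₜ[ℂ] b : Loop)⁆ =
      (LaurentPolynomial.T (j + k) : LaurentPolynomial ℂ) ⊗ₜ[ℂ] ⁅a, b⁆ := by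
  rw [LaurentPolynomial.T_add]
  exact LieAlgebra.ExtendScalars.bracket_tmul ℂ _ _ _ _ _ _ _

theorem lie_loopXPlus_loopXMinus (j k : ℤ) :
    ⁅loopXPlus j, loopXMinus k⁆ = loopH (j + k) := by
  rw [loopXPlus, loopXMinus, loop_lie_tmul, loopH]
  congr 1
  apply Subtype.ext
  rw [LieAlgebra.SpecialLinear.sl_bracket]
  ext a b
  fin_cases a <;> fin_cases b <;> simp [Matrix.mul_apply, Matrix.single]

theorem lie_loopH_loopXPlus (j k : ℤ) :
    ⁅loopH j, loopXPlus k⁆ = (2 : ℂ) • loopXPlus (j + k) := by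
  rw [loopXPlus, loopH, loop_lie_tmul, loopXPlus, ← TensorProduct.tmul_smul]
  congr 1
  apply Subtype.ext
  rw [LieAlgebra.SpecialLinear.sl_bracket]
  ext a b
  fin_cases a <;> fin_cases b <;> simp [Matrix.mul_apply, Matrix.single]
  norm_num

theorem lie_loopH_loopXMinus (j k : ℤ) :
    ⁅loopH j, loopXMinus k⁆ = (-2 : ℂ) • loopXMinus (j + k) := by
  rw [loopXMinus, loopH, loop_lie_tmul, loopXMinus, ← TensorProduct.tmul_smul]
  congr 1
  apply Subtype.ext
  rw [LieAlgebra.SpecialLinear.sl_bracket]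
  ext a b
  fin_cases a <;> fin_cases b <;> simp [Matrix.mul_apply, Matrix.single]
  norm_num

theorem lie_loopH_loopH (j k : ℤ) : ⁅loopH j, loopH k⁆ = 0 := by
  rw [loopH, loopH, loop_lie_tmul, lie_self, TensorProduct.tmul_zero]

theorem lie_loopXPlus_loopXPlus (j k : ℤ) : ⁅loopXPlus j, loopXPlus k⁆ = 0 := by
  rw [loopXPlus, loopXPlus, loop_lie_tmul, lie_self, TensorProduct.tmul_zero]

theorem lie_loopXMinus_loopXMinus (j k : ℤ) : ⁅loopXMinus j, loopXMinus k⁆ = 0 := by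
  rw [loopXMinus, loopXMinus, loop_lie_tmul, lie_self, TensorProduct.tmul_zero]

/-- The canonical map `L(sl₂) → U(L(sl₂))`. -/
noncomputable abbrev toULoop (x : Loop) : ULoop := UniversalEnvelopingAlgebra.ι ℂ x

theorem toULoop_mul_sub (x y : Loop) :
    toULoop x * toULoop y - toULoop y * toULoop x = toULoop ⁅x, y⁆ := by
  let _ : LieRing ULoop := LieRing.ofAssociativeRing
  exact ((UniversalEnvelopingAlgebra.ι ℂ).map_lie x y).symm

theorem toULoop_smul (c : ℂ) (x : Loop) : toULoop (c • x) = c • toULoop x := by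
  let _ : LieRing ULoop := LieRing.ofAssociativeRing
  exact (UniversalEnvelopingAlgebra.ι ℂ : Loop →ₗ⁅ℂ⁆ ULoop).toLinearMap.map_smul c x

/-- The Borel subalgebra `U(B)` of `U(L(sl₂))`: the unital subalgebra generated by
`h₀`, `x₀⁺` and `x₁⁻`. -/
noncomputable def borel : Subalgebra ℂ ULoop :=
  Algebra.adjoin ℂ {toULoop (loopH 0), toULoop (loopXPlus 0), toULoop (loopXMinus 1)}

theorem lie_mem_borel {x y : Loop} (hx : toULoop x ∈ borel) (hy : toULoop y ∈ borel) :
    toULoop ⁅x, y⁆ ∈ borel := by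
  rw [← toULoop_mul_sub]
  exact sub_mem (mul_mem hx hy) (mul_mem hy hx)

theorem mem_borel_of_smul {c : ℂ} (hc : c ≠ 0) {x : Loop} (h : toULoop (c • x) ∈ borel) :
    toULoop x ∈ borel := by
  have h2 := borel.smul_mem h c⁻¹
  rwa [toULoop_smul, smul_smul, inv_mul_cancel₀ hc, one_smul] at h2

theorem loopXPlus_zero_mem : toULoop (loopXPlus 0) ∈ borel :=
  Algebra.subset_adjoin (by simp)

theorem loopXMinus_one_mem : toULoop (loopXMinus 1) ∈ borel :=
  Algebra.subset_adjoin (by simp)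

theorem loopH_one_mem : toULoop (loopH 1) ∈ borel := by
  have h := lie_mem_borel loopXPlus_zero_mem loopXMinus_one_mem
  rwa [lie_loopXPlus_loopXMinus] at h

theorem loopXPlus_mem (k : ℕ) : toULoop (loopXPlus k) ∈ borel := by
  induction k with
  | zero => exact loopXPlus_zero_mem
  | succ k ih =>
    have h := lie_mem_borel loopH_one_mem ih
    rw [lie_loopH_loopXPlus] at h
    have h2 := mem_borel_of_smul (by norm_num) h
    rwa [show ((k + 1 : ℕ) : ℤ) = 1 + (k : ℤ) by push_cast; ring]

theorem loopXMinus_mem (k : ℕ) : toULoop (loopXMinus (k + 1)) ∈ borel := by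
  induction k with
  | zero => simpa using loopXMinus_one_mem
  | succ k ih =>
    have h := lie_mem_borel loopH_one_mem ih
    rw [lie_loopH_loopXMinus] at h
    have h2 := mem_borel_of_smul (by norm_num) h
    rwa [show ((k + 1 : ℕ) : ℤ) + 1 = 1 + ((k : ℤ) + 1) by push_cast; ring]

theorem loopH_mem (k : ℕ) : toULoop (loopH k) ∈ borel := by
  cases k with
  | zero => exact Algebra.subset_adjoin (by simp)
  | succ k =>
    have h := lie_mem_borel loopXPlus_zero_mem (loopXMinus_mem k)
    rw [lie_loopXPlus_loopXMinus, zero_add] at h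
    exact_mod_cast h

/-- The generator `x_k⁺` of `U(B)`, `k ≥ 0`. -/
noncomputable def xPlus (k : ℕ) : borel := ⟨toULoop (loopXPlus k), loopXPlus_mem k⟩

/-- The generator `h_k` of `U(B)`, `k ≥ 0`. -/
noncomputable def h (k : ℕ) : borel := ⟨toULoop (loopH k), loopH_mem k⟩

/-- The generator `x_k⁻` of `U(B)`, `k > 0`. -/
noncomputable def xMinus (k : ℕ) (hk : 0 < k) : borel :=
  ⟨toULoop (loopXMinus k), by
    obtain ⟨m, rfl⟩ := Nat.exists_eq_succ_of_ne_zero hk.ne'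
    exact_mod_cast loopXMinus_mem m⟩

theorem xPlus_mul_xMinus (j k : ℕ) (hk : 0 < k) :
    xPlus j * xMinus k hk = xMinus k hk * xPlus j + h (j + k) := by
  apply Subtype.ext
  have e := toULoop_mul_sub (loopXPlus j) (loopXMinus k)
  rw [lie_loopXPlus_loopXMinus, sub_eq_iff_eq_add'] at e
  simpa [xPlus, xMinus, h] using e

theorem h_mul_xMinus (j k : ℕ) (hk : 0 < k) :
    h j * xMinus k hk = xMinus k hk * h j + (-2 : ℂ) • xMinus (j + k) (by omega) := by
  apply Subtype.ext
  have e := toULoop_mul_sub (loopH j) (loopXMinus k)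
  rw [lie_loopH_loopXMinus, sub_eq_iff_eq_add', toULoop_smul] at e
  simpa [xMinus, h] using e

/-- The divided power `X ^ n / n!`. -/
noncomputable def divPow (X : borel) (n : ℕ) : borel := ((n.factorial : ℂ)⁻¹) • X ^ n

section Representation

variable {V : Type*} [AddCommGroup V] [Module ℂ V] [Module borel V] [IsScalarTower ℂ borel V]

/-- `Ψ` is a highest weight vector of `U(B)` with highest weight `d`. -/
structure IsHighestWeightVector (Ψ : V) (d : ℕ → ℂ) : Prop where
  ne_zero : Ψ ≠ 0
  xPlus_smul : ∀ k, xPlus k • Ψ = 0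
  h_smul : ∀ k, h k • Ψ = d k • Ψ

/-- `x₁⁻` is nilpotent of degree `r` (with respect to `Ψ`). -/
def NilpotentOfDegree (Ψ : V) (r : ℕ) : Prop :=
  xMinus 1 one_pos ^ (r + 1) • Ψ = 0 ∧ ∀ j, 0 < j → j ≤ r → xMinus 1 one_pos ^ j • Ψ ≠ 0

/-- The eigenvalue `λ_k` of `(x₀⁺)^(k) (x₁⁻)^(k)` on `Ψ`. For a highest weight vector it exists
and is unique, see `IsHighestWeightVector.lam_eq_iff`. -/
noncomputable def lam (Ψ : V) (k : ℕ) : ℂ :=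
  Classical.epsilon fun c : ℂ => (divPow (xPlus 0) k * divPow (xMinus 1 one_pos) k) • Ψ = c • Ψ

/-- The span of the vectors `x⁻_{k₁} ⋯ x⁻_{kₙ} Ψ` with `k₁, …, kₙ > 0`. -/
def sector (Ψ : V) : ℕ → Submodule ℂ V
  | 0 => Submodule.span ℂ {Ψ}
  | n + 1 => Submodule.span ℂ
      {v | ∃ (k : ℕ) (hk : 0 < k), ∃ w ∈ sector Ψ n, v = xMinus k hk • w}

theorem smul_comm_complex (b : borel) (c : ℂ) (v : V) : b • c • v = c • b • v := by
  rw [← smul_one_smul borel c v, smul_smul, ← smul_assoc c b v]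
  congr 1
  simp

theorem smul_mem_of_span (b : borel) {S : Set V} {W : Submodule ℂ V}
    (hS : ∀ v ∈ S, b • v ∈ W) {v : V} (hv : v ∈ Submodule.span ℂ S) : b • v ∈ W := by
  induction hv using Submodule.span_induction with
  | mem x hx => exact hS x hx
  | zero => rw [smul_zero]; exact W.zero_mem
  | add x y _ _ hx hy => rw [smul_add]; exact W.add_mem hx hy
  | smul c x _ hx => rw [smul_comm_complex]; exact W.smul_mem c hx

theorem xMinus_smul_mem_sector (Ψ : V) (n k : ℕ) (hk : 0 < k) {v : V} (hv : v ∈ sector Ψ n) :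
    xMinus k hk • v ∈ sector Ψ (n + 1) :=
  Submodule.subset_span ⟨k, hk, v, hv, rfl⟩

namespace IsHighestWeightVector

variable {Ψ : V} {d : ℕ → ℂ}

theorem h_smul_mem_sector (hΨ : IsHighestWeightVector Ψ d) (n : ℕ) :
    ∀ (j : ℕ) {v : V}, v ∈ sector Ψ n → h j • v ∈ sector Ψ n := by
  induction n with
  | zero =>
    intro j v hv
    refine smul_mem_of_span (h j) ?_ hv
    rintro _ rfl
    rw [hΨ.h_smul]
    exact Submodule.smul_mem _ _ (Submodule.mem_span_singleton_self _)
  | succ n ih =>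
    intro j v hv
    refine smul_mem_of_span (h j) ?_ hv
    rintro _ ⟨k, hk, w, hw, rfl⟩
    rw [← mul_smul, h_mul_xMinus, add_smul, mul_smul, smul_assoc]
    exact add_mem (xMinus_smul_mem_sector Ψ n k hk (ih j hw))
      (Submodule.smul_mem _ _ (xMinus_smul_mem_sector Ψ n _ _ hw))

theorem xPlus_smul_mem_sector (hΨ : IsHighestWeightVector Ψ d) (n : ℕ) :
    ∀ (j : ℕ) {v : V}, v ∈ sector Ψ (n + 1) → xPlus j • v ∈ sector Ψ n := by
  induction n with
  | zero =>
    intro j v hv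
    refine smul_mem_of_span (xPlus j) ?_ hv
    rintro _ ⟨k, hk, w, hw, rfl⟩
    rw [← mul_smul, xPlus_mul_xMinus, add_smul, mul_smul]
    have h0 : xPlus j • w = 0 := by
      have := smul_mem_of_span (xPlus j) (W := ⊥) (S := {Ψ})
        (by rintro _ rfl; simp [hΨ.xPlus_smul]) hw
      simpa using this
    rw [h0, smul_zero, zero_add]
    exact hΨ.h_smul_mem_sector 0 _ hw
  | succ n ih =>
    intro j v hv
    refine smul_mem_of_span (xPlus j) ?_ hv
    rintro _ ⟨k, hk, w, hw, rfl⟩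
    rw [← mul_smul, xPlus_mul_xMinus, add_smul, mul_smul]
    exact add_mem (xMinus_smul_mem_sector Ψ n k hk (ih j hw)) (hΨ.h_smul_mem_sector (n + 1) _ hw)

theorem xMinus_pow_smul_mem (Ψ : V) (k : ℕ) : xMinus 1 one_pos ^ k • Ψ ∈ sector Ψ k := by
  induction k with
  | zero =>
    rw [pow_zero, one_smul]
    exact Submodule.mem_span_singleton_self Ψ
  | succ k ih =>
    rw [pow_succ', mul_smul]
    exact xMinus_smul_mem_sector Ψ k 1 one_pos ih

theorem xPlus_pow_smul_mem (hΨ : IsHighestWeightVector Ψ d) (k n : ℕ) :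
    ∀ {v : V}, v ∈ sector Ψ (n + k) → xPlus 0 ^ k • v ∈ sector Ψ n := by
  induction k with
  | zero => intro v hv; simpa using hv
  | succ k ih =>
    intro v hv
    rw [pow_succ, mul_smul]
    exact ih (hΨ.xPlus_smul_mem_sector (n + k) 0 hv)

/-- `Ψ` is an eigenvector of `(x₀⁺)^(k) (x₁⁻)^(k)`, with eigenvalue `λ_k`. -/
theorem lam_spec (hΨ : IsHighestWeightVector Ψ d) (k : ℕ) :
    (divPow (xPlus 0) k * divPow (xMinus 1 one_pos) k) • Ψ = lam Ψ k • Ψ := by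
  refine Classical.epsilon_spec
    (p := fun c : ℂ => (divPow (xPlus 0) k * divPow (xMinus 1 one_pos) k) • Ψ = c • Ψ) ?_
  have h1 : xPlus 0 ^ k • xMinus 1 one_pos ^ k • Ψ ∈ sector Ψ 0 :=
    hΨ.xPlus_pow_smul_mem k 0 (by simpa using xMinus_pow_smul_mem Ψ k)
  obtain ⟨c, hc⟩ := Submodule.mem_span_singleton.mp h1
  refine ⟨(k.factorial : ℂ)⁻¹ * ((k.factorial : ℂ)⁻¹ * c), ?_⟩
  rw [divPow, divPow, mul_smul, smul_assoc, smul_assoc, smul_comm_complex, ← hc, smul_smul,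
    smul_smul, mul_assoc]

theorem lam_eq_iff (hΨ : IsHighestWeightVector Ψ d) (k : ℕ) (c : ℂ) :
    lam Ψ k = c ↔ (divPow (xPlus 0) k * divPow (xMinus 1 one_pos) k) • Ψ = c • Ψ := by
  rw [hΨ.lam_spec k]
  exact ⟨fun e => by rw [e], fun e => smul_left_injective ℂ hΨ.ne_zero e⟩

end IsHighestWeightVector

/-- The generalized Drinfeld polynomial `P_Ψ(u) = ∑_{k=0}^{r} λ_k (-u)^k`. -/
noncomputable def drinfeldPoly (Ψ : V) (r : ℕ) : Polynomial ℂ :=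
  ∑ k ∈ Finset.range (r + 1), Polynomial.C (lam Ψ k) * (-Polynomial.X) ^ k

/-- `a₁, …, a_r` are the evaluation parameters of `Ψ`, listed with multiplicity:
`P_Ψ(u) = ∏_{i=1}^{r} (1 - a_i u)`. -/
def HasEvaluationParameters (Ψ : V) (r : ℕ) (a : Fin r → ℂ) : Prop :=
  drinfeldPoly Ψ r = ∏ i, (1 - Polynomial.C (a i) * Polynomial.X)

end Representation

end SlTwoLoop

/-!
Write `x⁻ ⊗ t f` for the combination of the `x_{k+1}⁻` given by a polynomial `f`. Garland's formula
expresses `(x₀⁺)ⁿ (x₁⁻)ⁿ⁺¹ Ψ` as a multiple of `(x⁻ ⊗ t f_n) Ψ`, where `f_n` is determined by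
`λ_0, …, λ_n`. For `n = r` it shows that `x⁻ ⊗ t f` vanishes as soon as `f` vanishes at all the
evaluation parameters `a_i`, so that `V` only sees the values of polynomials at the `a_i`. Applying
`x₀⁺` once more gives Newton's identities for the weight of `Ψ`, which is therefore
`h ⊗ t f ↦ ∑ a_i f(a_i)`.

Lagrange interpolation now splits the action into `r` commuting copies of `sl₂`, one for each `a_i`,
and `Ψ` has weight `1` for every copy. Since `x₁⁻` is nilpotent, so is each lowering operator `y_i`;
hence `y_i² = 0` and `x_i y_i + y_i x_i = 1`. It follows that the `x_i` square to zero, so every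
nonzero vector can be raised to a nonzero vector killed by all `x_i`, and the projections `x_i y_i`
show that such a vector is a multiple of the generator `Ψ`.
-/

namespace SlTwoLoop

open Polynomial
open scoped Nat

/-! ### Powers in commutation relations -/

section Ring

variable {A : Type*} [Ring A] {e f h : A}

theorem commute_mul_self_of_anticomm (hef : e * f + f * e = 1) : Commute (e * e) f := by
  rw [commute_iff_eq]
  linear_combination (norm := noncomm_ring) e * hef - hef * e

theorem add_eq_zero_of_mul_self_eq_zero
    (hef : e * f = f * e + h) (hf : f * f = 0) : h * f + f * h = 0 := by
  linear_combination (norm := noncomm_ring) e * hf - hf * e - hef * f - f * hef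

end Ring

section Algebra

variable {K A : Type*} [CommRing K] [Ring A] [Algebra K A] {e f h z : A}

theorem mul_pow_succ_of_mul_eq_add (he : h * e = e * h + z) (hz : Commute z e) (n : ℕ) :
    h * e ^ (n + 1) = e ^ (n + 1) * h + ((n : K) + 1) • (z * e ^ n) := by
  induction n with
  | zero => simp [he]
  | succ n ih =>
    have hze : e ^ (n + 1) * z = z * e ^ (n + 1) := (hz.pow_right (n + 1)).eq.symm
    rw [pow_succ e (n + 1), ← mul_assoc, ih, add_mul, smul_mul_assoc, mul_assoc z, ← pow_succ,
      mul_assoc, he, mul_add, hze, mul_assoc]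
    push_cast
    module

theorem two_smul_pow_succ_mul (hef : e * f = f * e + h) (he : h * e = e * h + z)
    (hz : Commute z e) (n : ℕ) :
    (2 : K) • (e ^ (n + 1) * f) =
      (2 : K) • (f * e ^ (n + 1)) + ((n : K) + 1) • (h * e ^ n + e ^ n * h) := by
  induction n with
  | zero => simp only [hef, zero_add, pow_one, pow_zero, Nat.cast_zero, mul_one, one_mul]; module
  | succ n ih =>
    have hcomm := mul_pow_succ_of_mul_eq_add (K := K) he hz n
    have hstep : (2 : K) • (e ^ (n + 1 + 1) * f) = (2 : K) • (f * e ^ (n + 1 + 1)) +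
        (2 : K) • (h * e ^ (n + 1)) +
        ((n : K) + 1) • (h * e ^ (n + 1) - z * e ^ n + e ^ (n + 1) * h) := by
      have hehn : e * (h * e ^ n) = h * e ^ (n + 1) - z * e ^ n := by
        rw [← mul_assoc, ← sub_eq_iff_eq_add.mpr he, sub_mul, mul_assoc, ← pow_succ']
      rw [pow_succ' e (n + 1), mul_assoc, ← mul_smul_comm, ih, mul_add, mul_smul_comm,
        mul_smul_comm, ← mul_assoc, hef, mul_add, hehn, ← mul_assoc, ← pow_succ', add_mul,
        smul_add, mul_assoc]
    push_cast
    linear_combination (norm := module) hstep + hcomm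

end Algebra

theorem pow_eq_zero_of_mul_eq_add_smul {K A : Type*} [Field K] [CharZero K] [Ring A] [Algebra K A]
    {e h z : A} {b c : K} (he : h * e = e * h + b • z) (hzz : h * z = z * h + c • z)
    (hz : Commute z e) (hb : b ≠ 0) {n : ℕ} (hn : e ^ n = 0) : z ^ n = 0 := by
  suffices ∀ m k, z ^ k * e ^ m = 0 → z ^ (k + m) = 0 by
    simpa using this n 0 (by simpa using hn)
  intro m
  induction m with
  | zero => intro k hk; simpa using hk
  | succ m ih =>
    intro k hk
    rw [← Nat.add_assoc, Nat.add_right_comm]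
    refine ih (k + 1) ?_
    have hcomm := mul_pow_succ_of_mul_eq_add (K := K) he (hz.smul_left b) m
    have hzk : h * z ^ k = z ^ k * h + (k * c) • z ^ k := by
      cases k with
      | zero => simp
      | succ k =>
        rw [mul_pow_succ_of_mul_eq_add (K := K) hzz ((Commute.refl z).smul_left c) k,
          smul_mul_assoc, smul_smul, ← pow_succ', Nat.cast_add_one]
    have had : h * (z ^ k * e ^ (m + 1)) = z ^ k * e ^ (m + 1) * h +
        (k * c) • (z ^ k * e ^ (m + 1)) + (((m : K) + 1) * b) • (z ^ (k + 1) * e ^ m) := by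
      rw [← mul_assoc, hzk, add_mul, mul_assoc, hcomm, mul_add, smul_mul_assoc, mul_smul_comm,
        smul_mul_assoc, mul_smul_comm, pow_succ z]
      simp only [mul_assoc]
      module
    rw [hk, mul_zero, zero_mul, smul_zero, zero_add, zero_add, eq_comm] at had
    exact (smul_eq_zero.mp had).resolve_left (mul_ne_zero (by exact_mod_cast m.succ_ne_zero) hb)

/-! ### Garland polynomials -/

section Polynomials

variable {K : Type*} [Field K]

/-- For the eigenvalues `l k = λ_k` of a highest weight vector `Ψ`, the polynomial `f` for which
`(x₀⁺)ⁿ / n! · (x₁⁻)ⁿ⁺¹ / (n + 1)! · Ψ = (x⁻ ⊗ t f) Ψ`. -/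
noncomputable def garlandPoly (l : ℕ → K) : ℕ → K[X]
  | 0 => C (l 0)
  | n + 1 => C (l (n + 1)) - X * garlandPoly l n

theorem degree_garlandPoly {l : ℕ → K} (hl : l 0 ≠ 0) (n : ℕ) :
    (garlandPoly l n).degree = n := by
  induction n with
  | zero => simpa [garlandPoly] using degree_C hl
  | succ n ih =>
    have hX : (X * garlandPoly l n).degree = ((n + 1 : ℕ) : WithBot ℕ) := by
      rw [degree_mul, degree_X, ih, add_comm, Nat.cast_add_one]
    rw [garlandPoly, degree_sub_eq_right_of_degree_lt, hX]
    exact degree_C_le.trans_lt (hX ▸ mod_cast n.succ_pos)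

theorem linearMap_ext_garlandPoly {E : Type*} [AddCommGroup E] [Module K E] {l : ℕ → K}
    (hl : l 0 ≠ 0) {A B : K[X] →ₗ[K] E} (h : ∀ n, A (garlandPoly l n) = B (garlandPoly l n)) :
    A = B := by
  let S : Polynomial.Sequence K := ⟨garlandPoly l, degree_garlandPoly hl⟩
  exact LinearMap.ext_on_range (S.span fun n => (leadingCoeff_ne_zero.mpr (S.ne_zero n)).isUnit) h

variable {ι : Type*} [Fintype ι]

theorem eval_garlandPoly_coeff_prod [DecidableEq ι] (a : ι → K) (i : ι) (n : ℕ) :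
    (garlandPoly (∏ j, (1 + C (a j) * X)).coeff n).eval (a i) =
      (∏ j ∈ Finset.univ.erase i, (1 + C (a j) * X)).coeff n := by
  have hfactor := Finset.mul_prod_erase Finset.univ (fun j => 1 + C (a j) * X) (Finset.mem_univ i)
  induction n with
  | zero => simp [garlandPoly, ← hfactor, add_mul]
  | succ n ih =>
    rw [garlandPoly, eval_sub, eval_C, eval_mul, eval_X, ih, ← hfactor, add_mul, one_mul,
      coeff_add, mul_assoc, coeff_C_mul, coeff_X_mul, add_sub_cancel_right]

theorem eval_garlandPoly_coeff_prod_card (a : ι → K) (i : ι) :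
    (garlandPoly (∏ j, (1 + C (a j) * X)).coeff (Fintype.card ι)).eval (a i) = 0 := by
  classical
  rw [eval_garlandPoly_coeff_prod]
  refine coeff_eq_zero_of_natDegree_lt <| (natDegree_prod_le _ _).trans_lt ?_
  have hfactor (j : ι) : (1 + C (a j) * X).natDegree ≤ 1 := by compute_degree
  calc ∑ j ∈ Finset.univ.erase i, (1 + C (a j) * X).natDegree
      ≤ (Finset.univ.erase i).card :=
        (Finset.sum_le_card_nsmul _ _ 1 fun j _ => hfactor j).trans_eq (mul_one _)
    _ < Fintype.card ι := Finset.card_erase_lt_of_mem (Finset.mem_univ i)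

theorem sum_mul_eval_garlandPoly_coeff_prod (a : ι → K) (n : ℕ) :
    ∑ i, a i * (garlandPoly (∏ j, (1 + C (a j) * X)).coeff n).eval (a i) =
      (n + 1) * (∏ j, (1 + C (a j) * X)).coeff (n + 1) := by
  classical
  rw [mul_comm, ← coeff_derivative, derivative_prod_finset, finsetSum_coeff]
  refine Finset.sum_congr rfl fun i _ => ?_
  rw [eval_garlandPoly_coeff_prod, derivative_add, derivative_one, zero_add,
    derivative_C_mul_X, coeff_mul_C, mul_comm]

theorem dvd_of_eval_eq_zero {a : ι → K} (ha : Function.Injective a) {f g : K[X]}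
    (hg : g.degree = Fintype.card ι) (hga : ∀ i, g.eval (a i) = 0)
    (hfa : ∀ i, f.eval (a i) = 0) : g ∣ f := by
  have hg0 : g ≠ 0 := fun h => by simp [h] at hg
  rw [← EuclideanDomain.mod_eq_zero]
  refine eq_zero_of_degree_lt_of_eval_index_eq_zero Finset.univ ha.injOn ?_ fun i _ => ?_
  · rw [Finset.card_univ, ← hg]
    exact degree_mod_lt f hg0
  · rw [EuclideanDomain.mod_eq_sub_mul_div, eval_sub, eval_mul, hfa, hga, zero_mul, sub_zero]

end Polynomials

/-! ### Two-dimensional sites -/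

section CyclicVector

variable {K V ι : Type*} [CommRing K] [AddCommGroup V] [Module K V] {x y : ι → Module.End K V}
  {Ψ : V}

/-- `Ψ` is a cyclic vector of the family of operators `y`: no proper subspace that is stable under
every `y i` contains `Ψ`. -/
def IsCyclicVector (y : ι → Module.End K V) (Ψ : V) : Prop :=
  ∀ N : Submodule K V, Ψ ∈ N → (∀ i, ∀ v ∈ N, y i v ∈ N) → N = ⊤

theorem IsCyclicVector.eq_of_commute (hΨ : IsCyclicVector y Ψ) {A B : Module.End K V}
    (hA : ∀ i, Commute A (y i)) (hB : ∀ i, Commute B (y i)) (hAB : A Ψ = B Ψ) : A = B := by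
  refine LinearMap.eqLocus_eq_top.mp (hΨ (LinearMap.eqLocus A B) hAB fun i v hv => ?_)
  rw [LinearMap.mem_eqLocus] at hv ⊢
  rw [← Module.End.mul_apply, ← Module.End.mul_apply, (hA i).eq, (hB i).eq, Module.End.mul_apply,
    hv, Module.End.mul_apply]

theorem exists_ne_zero_forall_apply_eq_zero (hcomm : ∀ i j, Commute (x i) (x j))
    (hsq : ∀ i, x i * x i = 0) {W : Submodule K V} (hW : W ≠ ⊥)
    (hstable : ∀ i, ∀ v ∈ W, x i v ∈ W) (s : Finset ι) :
    ∃ u ∈ W, u ≠ 0 ∧ ∀ i ∈ s, x i u = 0 := by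
  classical
  induction s using Finset.induction_on with
  | empty => simpa using W.exists_mem_ne_zero_of_ne_bot hW
  | insert j s _ ih =>
    obtain ⟨u, huW, hu, hus⟩ := ih
    by_cases hju : x j u = 0
    · exact ⟨u, huW, hu, by simpa [hju] using hus⟩
    · refine ⟨x j u, hstable j u huW, hju, fun i hi => ?_⟩
      obtain rfl | his := Finset.mem_insert.mp hi
      · rw [← Module.End.mul_apply, hsq, LinearMap.zero_apply]
      · rw [← Module.End.mul_apply, (hcomm i j).eq, Module.End.mul_apply, hus i his, map_zero]

/-- The relations of raising operators `x i` and lowering operators `y i` on a tensor product of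
two-dimensional representations of `sl₂`, one for each site `i`: different sites commute, and each
site satisfies the anticommutation relations of a single fermion. -/
structure IsSpinHalfSystem (x y : ι → Module.End K V) : Prop where
  commute_raise : ∀ i j, Commute (x i) (x j)
  commute_lower : ∀ i j, Commute (y i) (y j)
  commute_raise_lower : ∀ i j, i ≠ j → Commute (x i) (y j)
  lower_mul_self : ∀ i, y i * y i = 0
  raise_mul_lower_add : ∀ i, x i * y i + y i * x i = 1

namespace IsSpinHalfSystem

theorem raise_mul_self (hxy : IsSpinHalfSystem x y) (hΨ : IsCyclicVector y Ψ) {i : ι}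
    (hx : x i Ψ = 0) : x i * x i = 0 := by
  refine hΨ.eq_of_commute (fun j => ?_) (fun j => Commute.zero_left _) (by simp [hx])
  obtain rfl | hij := eq_or_ne i j
  · exact commute_mul_self_of_anticomm (hxy.raise_mul_lower_add i)
  · exact (hxy.commute_raise_lower i j hij).mul_left (hxy.commute_raise_lower i j hij)

theorem mem_span_singleton [Finite ι] (hxy : IsSpinHalfSystem x y) (hΨ : IsCyclicVector y Ψ)
    (hx : ∀ i, x i Ψ = 0) {v : V} (hv : ∀ i, x i v = 0) : v ∈ Submodule.span K {Ψ} := by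
  classical
  have := Fintype.ofFinite ι
  let N (s : Finset ι) : Submodule K V := Submodule.span K {Ψ} ⊔ ⨆ i ∈ s, LinearMap.range (y i)
  have hvacuum (i : ι) {u : V} (hu : x i u = 0) : (x i * y i) u = u := by
    simpa [hu] using LinearMap.congr_fun (hxy.raise_mul_lower_add i) u
  -- The projection `x j * y j` fixes `v` and `Ψ`, annihilates the range of `y j`, and preserves the
  -- ranges of the other `y i`.
  have hproj (j : ι) (s : Finset ι) : N (insert j s) ≤ (N s).comap (x j * y j) := by
    have hΨN : Submodule.span K {Ψ} ≤ (N s).comap (x j * y j) := by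
      rw [Submodule.span_singleton_le_iff_mem, Submodule.mem_comap, hvacuum j (hx j)]
      exact Submodule.mem_sup_left (Submodule.mem_span_singleton_self Ψ)
    refine sup_le hΨN (iSup₂_le fun i hi => ?_)
    rintro _ ⟨w, rfl⟩
    rw [Submodule.mem_comap, ← Module.End.mul_apply]
    obtain rfl | hij := eq_or_ne i j
    · rw [mul_assoc, hxy.lower_mul_self, mul_zero]
      exact zero_mem _
    · have hcomm := (hxy.commute_raise_lower j i hij.symm).mul_left (hxy.commute_lower j i)
      rw [hcomm.eq]
      exact Submodule.mem_sup_right <| Submodule.mem_iSup_of_mem i <| Submodule.mem_iSup_of_mem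
        (Finset.mem_of_mem_insert_of_ne hi hij) ⟨_, rfl⟩
  have hmem (s : Finset ι) (hs : v ∈ N s) : v ∈ N ∅ := by
    induction s using Finset.induction_on with
    | empty => exact hs
    | insert j s _ ih => exact ih (hvacuum j (hv j) ▸ hproj j s hs)
  have htop : N Finset.univ = ⊤ :=
    hΨ _ (Submodule.mem_sup_left (Submodule.mem_span_singleton_self Ψ)) fun i w _ =>
      Submodule.mem_sup_right <| Submodule.mem_iSup_of_mem i <| Submodule.mem_iSup_of_mem
        (Finset.mem_univ i) ⟨w, rfl⟩
  simpa [N] using hmem Finset.univ (htop ▸ Submodule.mem_top)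

end IsSpinHalfSystem

end CyclicVector

theorem IsSpinHalfSystem.mem_of_stable {K V ι : Type*} [Field K] [AddCommGroup V] [Module K V]
    [Finite ι] {x y : ι → Module.End K V} {Ψ : V} (hxy : IsSpinHalfSystem x y)
    (hΨ : IsCyclicVector y Ψ) (hx : ∀ i, x i Ψ = 0) {W : Submodule K V} (hW : W ≠ ⊥)
    (hstable : ∀ i, ∀ v ∈ W, x i v ∈ W) : Ψ ∈ W := by
  have := Fintype.ofFinite ι
  obtain ⟨u, huW, hu, hxu⟩ := exists_ne_zero_forall_apply_eq_zero hxy.commute_raise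
    (fun i => hxy.raise_mul_self hΨ (hx i)) hW hstable Finset.univ
  obtain ⟨c, rfl⟩ := Submodule.mem_span_singleton.mp <|
    hxy.mem_span_singleton hΨ hx fun i => hxu i (Finset.mem_univ i)
  exact (W.smul_mem_iff (left_ne_zero_of_smul hu)).mp huW

theorem pow_succ_toEnd_f_eq_zero {K L M : Type*} [Field K] [CharZero K] [LieRing L] [LieAlgebra K L]
    [AddCommGroup M] [Module K M] [LieRingModule L M] [LieModule K L M] {h e f : L} {m : M}
    {t : IsSl2Triple h e f} {μ : ℕ} (P : t.HasPrimitiveVectorWith m (μ : K)) {n : ℕ}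
    (hn : (LieModule.toEnd K L M f ^ n) m = 0) : (LieModule.toEnd K L M f ^ (μ + 1)) m = 0 := by
  induction n with
  | zero => exact absurd hn P.ne_zero
  | succ n ih =>
    obtain hle | hlt := le_or_gt n μ
    · exact Module.End.pow_map_zero_of_le (Nat.succ_le_succ hle) hn
    · refine ih ?_
      have hstring := P.lie_e_pow_succ_toEnd_f n
      rw [hn, lie_zero, eq_comm, smul_eq_zero, mul_eq_zero] at hstring
      refine hstring.resolve_left (not_or_intro (mod_cast n.succ_ne_zero) ?_)
      rw [sub_eq_zero, Nat.cast_inj]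
      exact hlt.ne

/-! ### Highest weight vectors of the Borel subalgebra -/

/-- A representation on `V` of the Borel subalgebra `n⁺[t] ⊕ h[t] ⊕ t n⁻[t]` of `sl₂[t]`: for a
polynomial `f` in `t`, `raise f = x⁺ ⊗ f`, `cartan f = h ⊗ f` and `lower f = x⁻ ⊗ t f`. The factor
`t` in `lower` is what produces the factor `X` in `raise_mul_lower`. -/
structure BorelOperators (K V : Type*) [CommRing K] [AddCommGroup V] [Module K V] where
  raise : K[X] →ₗ[K] Module.End K V
  cartan : K[X] →ₗ[K] Module.End K V
  lower : K[X] →ₗ[K] Module.End K V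
  raise_mul_lower : ∀ f g, raise f * lower g = lower g * raise f + cartan (X * (f * g))
  cartan_mul_lower : ∀ f g, cartan f * lower g = lower g * cartan f + (-2 : K) • lower (f * g)
  cartan_mul_raise : ∀ f g, cartan f * raise g = raise g * cartan f + (2 : K) • raise (f * g)
  commute_raise : ∀ f g, Commute (raise f) (raise g)
  commute_lower : ∀ f g, Commute (lower f) (lower g)

namespace BorelOperators

section CommRing

variable {K V : Type*} [CommRing K] [AddCommGroup V] [Module K V]

/-- `Ψ` is a cyclic highest weight vector whose highest weight is the linear form `D`. -/
structure IsCyclicHighestWeight (T : BorelOperators K V) (Ψ : V) (D : K[X] →ₗ[K] K) : Prop where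
  ne_zero : Ψ ≠ 0
  raise_apply : ∀ f, T.raise f Ψ = 0
  cartan_apply : ∀ f, T.cartan f Ψ = D f • Ψ
  isCyclic : IsCyclicVector T.lower Ψ

variable {T : BorelOperators K V} {Ψ : V} {D : K[X] →ₗ[K] K}

theorem cartan_X_mul_eq_zero {f : K[X]} (hf : T.lower f = 0) (g : K[X]) :
    T.cartan (X * (g * f)) = 0 := by
  have hcomm := T.raise_mul_lower g f
  rwa [hf, mul_zero, zero_mul, zero_add, eq_comm] at hcomm

theorem raise_one_mul_lower_one (T : BorelOperators K V) :
    T.raise 1 * T.lower 1 = T.lower 1 * T.raise 1 + T.cartan X := by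
  rw [T.raise_mul_lower, mul_one, mul_one]

theorem two_smul_raise_pow_succ_mul_lower (T : BorelOperators K V) (n : ℕ) :
    (2 : K) • (T.raise 1 ^ (n + 1) * T.lower 1) = (2 : K) • (T.lower 1 * T.raise 1 ^ (n + 1)) +
      ((n : K) + 1) • (T.cartan X * T.raise 1 ^ n + T.raise 1 ^ n * T.cartan X) := by
  refine two_smul_pow_succ_mul T.raise_one_mul_lower_one ?_
    ((T.commute_raise X 1).smul_left (2 : K)) n
  rw [T.cartan_mul_raise, mul_one]

theorem two_smul_raise_mul_lower_pow_succ (T : BorelOperators K V) (n : ℕ) :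
    (2 : K) • (T.raise 1 * T.lower 1 ^ (n + 1)) = (2 : K) • (T.lower 1 ^ (n + 1) * T.raise 1) +
      ((n : K) + 1) • (T.cartan X * T.lower 1 ^ n + T.lower 1 ^ n * T.cartan X) := by
  have hFE : T.lower 1 * T.raise 1 = T.raise 1 * T.lower 1 + -T.cartan X := by
    rw [T.raise_one_mul_lower_one, add_neg_cancel_right]
  have hHF : -T.cartan X * T.lower 1 = T.lower 1 * -T.cartan X + (2 : K) • T.lower X := by
    rw [neg_mul, mul_neg, T.cartan_mul_lower, mul_one]
    module
  have hcomm := two_smul_pow_succ_mul (K := K) hFE hHF ((T.commute_lower X 1).smul_left 2) n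
  rw [hcomm, neg_mul, mul_neg]
  module

namespace IsCyclicHighestWeight

theorem lower_eq_zero (hΨ : T.IsCyclicHighestWeight Ψ D) {f : K[X]} (hf : T.lower f Ψ = 0) :
    T.lower f = 0 :=
  hΨ.isCyclic.eq_of_commute (T.commute_lower f) (fun _ => Commute.zero_left _) hf

theorem raise_eq_zero (hΨ : T.IsCyclicHighestWeight Ψ D) {f : K[X]} (hf : T.lower f = 0) :
    T.raise f = 0 := by
  refine hΨ.isCyclic.eq_of_commute (fun g => ?_) (fun _ => Commute.zero_left _) (hΨ.raise_apply f)
  rw [commute_iff_eq, T.raise_mul_lower, mul_comm f g, cartan_X_mul_eq_zero hf, add_zero]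

end IsCyclicHighestWeight

end CommRing

variable {K V : Type*} [Field K] [CharZero K] [AddCommGroup V] [Module K V]
  {T : BorelOperators K V} {Ψ : V} {D : K[X] →ₗ[K] K}

theorem lower_mul_eq_zero {f : K[X]} (hf : T.lower f = 0) (g : K[X]) : T.lower (g * f) = 0 := by
  have hcomm := T.cartan_mul_lower g f
  rw [hf, mul_zero, zero_mul, zero_add, eq_comm] at hcomm
  exact (smul_eq_zero.mp hcomm).resolve_left (by norm_num)

namespace IsCyclicHighestWeight

/-- The induction step balances the commutators of the last raising operator with
`lower 1 ^ (n + 2)` and of the last lowering operator with `raise 1 ^ (n + 1)`. -/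
theorem raise_pow_lower_pow_succ_apply (hΨ : T.IsCyclicHighestWeight Ψ D) {l : ℕ → K}
    (hl : ∀ n, (T.raise 1 ^ n) ((T.lower 1 ^ n) Ψ) = ((n ! : K) ^ 2 * l n) • Ψ) (n : ℕ) :
    (T.raise 1 ^ n) ((T.lower 1 ^ (n + 1)) Ψ) =
      ((n ! : K) * (n + 1)!) • T.lower (garlandPoly l n) Ψ := by
  have hC (c : K) : T.lower (C c) = c • T.lower 1 := by rw [← map_smul, smul_eq_C_mul, mul_one]
  induction n with
  | zero =>
    have h0 : Ψ = l 0 • Ψ := by simpa using hl 0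
    calc (T.raise 1 ^ 0) ((T.lower 1 ^ 1) Ψ) = T.lower 1 (l 0 • Ψ) := by simp [← h0]
      _ = (((0)! : K) * (0 + 1)!) • T.lower (garlandPoly l 0) Ψ := by simp [garlandPoly, hC]
  | succ n ih =>
    have hA := LinearMap.congr_fun (T.two_smul_raise_pow_succ_mul_lower n)
      ((T.lower 1 ^ (n + 1)) Ψ)
    have hB := congrArg (T.raise 1 ^ n) <|
      LinearMap.congr_fun (T.two_smul_raise_mul_lower_pow_succ (n + 1)) Ψ
    have hH : T.cartan X (T.lower (garlandPoly l n) Ψ) = D X • T.lower (garlandPoly l n) Ψ +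
        (-2 : K) • T.lower (X * garlandPoly l n) Ψ := by
      rw [← Module.End.mul_apply, T.cartan_mul_lower, LinearMap.add_apply, Module.End.mul_apply,
        hΨ.cartan_apply, map_smul, LinearMap.smul_apply]
    have hfact : ((n + 1 + 1)! : K) = (n + 2) * (n + 1)! := by
      rw [Nat.factorial_succ]; push_cast; ring
    have hfact' : ((n + 1)! : K) = (n + 1) * n ! := by
      rw [Nat.factorial_succ]; push_cast; ring
    simp only [LinearMap.smul_apply, LinearMap.add_apply,
      Module.End.mul_apply, hl, ih, hH, hΨ.raise_apply, hΨ.cartan_apply, map_smul, map_add,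
      map_zero] at hA hB
    rw [← Module.End.mul_apply (T.raise 1 ^ n) (T.raise 1), ← pow_succ] at hB
    rw [← Module.End.mul_apply (T.lower 1), ← pow_succ'] at hA
    rw [garlandPoly, map_sub, hC, LinearMap.sub_apply, LinearMap.smul_apply]
    refine smul_right_injective V (two_ne_zero (α := K)) ?_
    push_cast at hA hB ⊢
    simp only [hfact, hfact'] at hA hB ⊢
    linear_combination (norm := module) ((n : K) + 2) • hA - ((n : K) + 1) • hB

theorem weight_X_mul_garlandPoly (hΨ : T.IsCyclicHighestWeight Ψ D) {l : ℕ → K}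
    (hl : ∀ n, (T.raise 1 ^ n) ((T.lower 1 ^ n) Ψ) = ((n ! : K) ^ 2 * l n) • Ψ) (n : ℕ) :
    D (X * garlandPoly l n) = (n + 1) * l (n + 1) := by
  have hn : ((n ! : K) * (n + 1)!) ≠ 0 := by
    exact_mod_cast mul_ne_zero n.factorial_ne_zero (n + 1).factorial_ne_zero
  have hraise : (T.raise 1 * T.lower (garlandPoly l n)) Ψ = D (X * garlandPoly l n) • Ψ := by
    rw [T.raise_mul_lower, one_mul, LinearMap.add_apply, Module.End.mul_apply, hΨ.raise_apply,
      map_zero, zero_add, hΨ.cartan_apply]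
  have heq : ((n ! : K) * (n + 1)! * D (X * garlandPoly l n)) • Ψ =
      (((n + 1)! : K) ^ 2 * l (n + 1)) • Ψ := by
    rw [← hl, pow_succ' (T.raise 1), Module.End.mul_apply, hΨ.raise_pow_lower_pow_succ_apply hl,
      map_smul, ← Module.End.mul_apply, hraise, smul_smul]
  refine mul_left_cancel₀ hn ((smul_left_injective K hΨ.ne_zero heq).trans ?_)
  rw [Nat.factorial_succ]
  push_cast
  ring

end IsCyclicHighestWeight

end BorelOperators

/-! ### Evaluation parameters -/

namespace BorelOperators

section Evaluation

variable {K V ι : Type*} [Field K] [AddCommGroup V] [Module K V] [Fintype ι]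

/-- `Ψ` is a cyclic highest weight vector with evaluation parameters `a`, as in the tensor product
of the two-dimensional evaluation representations at the points `a i`: the operators `lower f`
depend only on the values `f (a i)`, and each `a i` contributes the weight `1`. -/
structure IsEvaluationHighestWeight (T : BorelOperators K V) (Ψ : V) (D : K[X] →ₗ[K] K)
    (a : ι → K) : Prop extends T.IsCyclicHighestWeight Ψ D where
  weight_X_mul : ∀ f, D (X * f) = ∑ i, a i * f.eval (a i)
  lower_eq_zero_of_eval : ∀ f, (∀ i, f.eval (a i) = 0) → T.lower f = 0

theorem IsCyclicHighestWeight.isEvaluationHighestWeight [CharZero K] {T : BorelOperators K V}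
    {Ψ : V} {D : K[X] →ₗ[K] K} {a : ι → K} (hΨ : T.IsCyclicHighestWeight Ψ D)
    (ha : Function.Injective a)
    (hl : ∀ n, (T.raise 1 ^ n) ((T.lower 1 ^ n) Ψ) =
      ((n ! : K) ^ 2 * (∏ i, (1 + C (a i) * X)).coeff n) • Ψ)
    (hlower : (T.lower 1 ^ (Fintype.card ι + 1)) Ψ = 0) :
    T.IsEvaluationHighestWeight Ψ D a := by
  have hl0 : (∏ i, (1 + C (a i) * X)).coeff 0 ≠ 0 := by
    simp [coeff_zero_eq_eval_zero, eval_prod]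
  refine { hΨ with weight_X_mul := fun f => ?_, lower_eq_zero_of_eval := fun f hf => ?_ }
  · let sumEval : K[X] →ₗ[K] K := ∑ i, a i • leval (a i)
    have hD : D ∘ₗ LinearMap.mulLeft K X = sumEval := linearMap_ext_garlandPoly hl0 fun n => by
      simp [sumEval, hΨ.weight_X_mul_garlandPoly hl, ← sum_mul_eval_garlandPoly_coeff_prod]
    simpa [sumEval] using LinearMap.congr_fun hD f
  · have hgarland : T.lower (garlandPoly (∏ i, (1 + C (a i) * X)).coeff (Fintype.card ι)) = 0 := by
      have hzero := hΨ.raise_pow_lower_pow_succ_apply hl (Fintype.card ι)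
      rw [hlower, map_zero, eq_comm, smul_eq_zero] at hzero
      refine hΨ.lower_eq_zero (hzero.resolve_left ?_)
      exact_mod_cast mul_ne_zero (Nat.factorial_ne_zero _) (Nat.factorial_ne_zero _)
    obtain ⟨g, rfl⟩ := dvd_of_eval_eq_zero ha (degree_garlandPoly hl0 _)
      (eval_garlandPoly_coeff_prod_card a) hf
    rw [mul_comm]
    exact lower_mul_eq_zero hgarland g

namespace IsEvaluationHighestWeight

variable {T : BorelOperators K V} {Ψ : V} {D : K[X] →ₗ[K] K} {a : ι → K}

theorem lower_congr (hΨ : T.IsEvaluationHighestWeight Ψ D a) {f g : K[X]}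
    (hfg : ∀ i, f.eval (a i) = g.eval (a i)) : T.lower f = T.lower g := by
  rw [← sub_eq_zero, ← map_sub]
  exact hΨ.lower_eq_zero_of_eval _ fun i => by rw [eval_sub, hfg, sub_self]

theorem raise_congr (hΨ : T.IsEvaluationHighestWeight Ψ D a) {f g : K[X]}
    (hfg : ∀ i, f.eval (a i) = g.eval (a i)) : T.raise f = T.raise g := by
  rw [← sub_eq_zero, ← map_sub]
  refine hΨ.raise_eq_zero ?_
  rw [map_sub, hΨ.lower_congr hfg, sub_self]

theorem cartan_X_mul_congr (hΨ : T.IsEvaluationHighestWeight Ψ D a) {f g : K[X]}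
    (hfg : ∀ i, f.eval (a i) = g.eval (a i)) : T.cartan (X * f) = T.cartan (X * g) := by
  have hlower : T.lower (f - g) = 0 := by rw [map_sub, hΨ.lower_congr hfg, sub_self]
  rw [← sub_eq_zero, ← map_sub, ← mul_sub, ← one_mul (f - g)]
  exact cartan_X_mul_eq_zero hlower 1

end IsEvaluationHighestWeight

variable [DecidableEq ι]

/-- The multiple of the Lagrange polynomial of the point `a i` for which `t * dualPoly a i` takes
the value `1` at `a i`. -/
noncomputable def dualPoly (a : ι → K) (i : ι) : K[X] :=
  C (a i)⁻¹ * Lagrange.basis Finset.univ a i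

theorem eval_dualPoly {a : ι → K} (ha : Function.Injective a) (i j : ι) :
    (dualPoly a i).eval (a j) = if i = j then (a i)⁻¹ else 0 := by
  rw [dualPoly, eval_mul, eval_C]
  split_ifs with hij
  · rw [← hij, Lagrange.eval_basis_self ha.injOn (Finset.mem_univ i), mul_one]
  · rw [Lagrange.eval_basis_of_ne hij (Finset.mem_univ j), mul_zero]

theorem eval_X_mul_dualPoly {a : ι → K} (ha : Function.Injective a) {i : ι} (hi : a i ≠ 0) (j : ι) :
    (X * dualPoly a i).eval (a j) = if i = j then 1 else 0 := by
  rw [eval_mul, eval_X, eval_dualPoly ha]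
  split_ifs with hij
  · rw [← hij, mul_inv_cancel₀ hi]
  · exact mul_zero _

theorem eval_X_mul_dualPoly_mul {a : ι → K} (ha : Function.Injective a) (i j : ι) (f : K[X]) :
    (X * dualPoly a i * f).eval (a j) = ((a i * f.eval (a i)) • dualPoly a i).eval (a j) := by
  rw [eval_mul, eval_mul, eval_X, eval_smul, eval_dualPoly ha, smul_eq_mul]
  split_ifs with hij
  · rw [hij]
    ring
  · simp only [mul_zero, zero_mul]

/-- The operator `x⁺` acting on the tensor factor at `a i`. -/
noncomputable def siteRaise (T : BorelOperators K V) (a : ι → K) (i : ι) : Module.End K V :=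
  T.raise (X * dualPoly a i)

/-- The operator `h` acting on the tensor factor at `a i`. -/
noncomputable def siteCartan (T : BorelOperators K V) (a : ι → K) (i : ι) : Module.End K V :=
  T.cartan (X * dualPoly a i)

/-- The operator `x⁻` acting on the tensor factor at `a i`. -/
noncomputable def siteLower (T : BorelOperators K V) (a : ι → K) (i : ι) : Module.End K V :=
  T.lower (dualPoly a i)

namespace IsEvaluationHighestWeight

variable {T : BorelOperators K V} {Ψ : V} {D : K[X] →ₗ[K] K} {a : ι → K}

variable (ha : Function.Injective a)
include ha

theorem siteRaise_mul_lower (hΨ : T.IsEvaluationHighestWeight Ψ D a) (i : ι) (f : K[X]) :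
    T.siteRaise a i * T.lower f =
      T.lower f * T.siteRaise a i + (a i * f.eval (a i)) • T.siteCartan a i := by
  rw [siteRaise, T.raise_mul_lower, siteCartan, ← map_smul, ← mul_smul_comm,
    hΨ.cartan_X_mul_congr fun j => eval_X_mul_dualPoly_mul ha i j f]

theorem siteCartan_mul_lower (hΨ : T.IsEvaluationHighestWeight Ψ D a) (i : ι) (f : K[X]) :
    T.siteCartan a i * T.lower f =
      T.lower f * T.siteCartan a i + (-2 * (a i * f.eval (a i))) • T.siteLower a i := by
  rw [siteCartan, T.cartan_mul_lower, siteLower, mul_smul, ← map_smul T.lower (a i * _),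
    hΨ.lower_congr fun j => eval_X_mul_dualPoly_mul ha i j f]

variable (ha0 : ∀ i, a i ≠ 0)
include ha0

theorem siteCartan_mul_siteRaise (hΨ : T.IsEvaluationHighestWeight Ψ D a) (i : ι) :
    T.siteCartan a i * T.siteRaise a i =
      T.siteRaise a i * T.siteCartan a i + (2 : K) • T.siteRaise a i := by
  rw [siteCartan, siteRaise, T.cartan_mul_raise]
  congr 2
  refine hΨ.raise_congr fun j => ?_
  rw [eval_mul, eval_X_mul_dualPoly ha (ha0 i)]
  split_ifs <;> simp

theorem lower_eq_sum_siteLower (hΨ : T.IsEvaluationHighestWeight Ψ D a) (f : K[X]) :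
    T.lower f = ∑ i, (a i * f.eval (a i)) • T.siteLower a i := by
  simp only [siteLower, ← map_smul, ← map_sum]
  refine hΨ.lower_congr fun j => ?_
  simp [eval_finsetSum, eval_dualPoly ha, mul_right_comm, ha0]

theorem siteCartan_apply (hΨ : T.IsEvaluationHighestWeight Ψ D a) (i : ι) :
    T.siteCartan a i Ψ = Ψ := by
  have hweight : D (X * dualPoly a i) = 1 := by
    simp [hΨ.weight_X_mul, eval_dualPoly ha, ha0]
  rw [siteCartan, hΨ.cartan_apply, hweight, one_smul]

theorem isCyclicVector_siteLower (hΨ : T.IsEvaluationHighestWeight Ψ D a) :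
    IsCyclicVector (T.siteLower a) Ψ := fun N hN hstable =>
  hΨ.isCyclic N hN fun f v hv => by
    rw [hΨ.lower_eq_sum_siteLower ha ha0, LinearMap.sum_apply]
    exact sum_mem fun i _ => N.smul_mem _ (hstable i v hv)

end IsEvaluationHighestWeight

end Evaluation

end BorelOperators

namespace BorelOperators.IsEvaluationHighestWeight

variable {K V ι : Type*} [Field K] [AddCommGroup V] [Module K V] [Fintype ι]
  [DecidableEq ι] {T : BorelOperators K V} {Ψ : V} {D : K[X] →ₗ[K] K} {a : ι → K}

theorem siteRaise_mul_siteLower (hΨ : T.IsEvaluationHighestWeight Ψ D a)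
    (ha : Function.Injective a) {i : ι} (hi : a i ≠ 0) :
    T.siteRaise a i * T.siteLower a i =
      T.siteLower a i * T.siteRaise a i + T.siteCartan a i := by
  rw [siteLower, hΨ.siteRaise_mul_lower ha, eval_dualPoly ha, if_pos rfl, mul_inv_cancel₀ hi,
    one_smul]

theorem siteCartan_mul_siteLower (hΨ : T.IsEvaluationHighestWeight Ψ D a)
    (ha : Function.Injective a) {i : ι} (hi : a i ≠ 0) :
    T.siteCartan a i * T.siteLower a i =
      T.siteLower a i * T.siteCartan a i + (-2 : K) • T.siteLower a i := by
  nth_rw 1 2 [siteLower]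
  rw [hΨ.siteCartan_mul_lower ha, eval_dualPoly ha, if_pos rfl, mul_inv_cancel₀ hi, mul_one]

attribute [local instance] LieRing.ofAssociativeRing

theorem isSl2Triple (hΨ : T.IsEvaluationHighestWeight Ψ D a)
    (ha : Function.Injective a) (ha0 : ∀ i, a i ≠ 0) (i : ι) :
    IsSl2Triple (T.siteCartan a i) (T.siteRaise a i) (T.siteLower a i) where
  h_ne_zero h0 := hΨ.ne_zero (by rw [← hΨ.siteCartan_apply ha ha0 i, h0, LinearMap.zero_apply])
  lie_e_f := by
    rw [Ring.lie_def, hΨ.siteRaise_mul_siteLower ha (ha0 i), add_sub_cancel_left]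
  lie_h_e_nsmul := by
    rw [Ring.lie_def, hΨ.siteCartan_mul_siteRaise ha ha0, add_sub_cancel_left, ofNat_smul_eq_nsmul]
  lie_h_f_nsmul := by
    rw [Ring.lie_def, hΨ.siteCartan_mul_siteLower ha (ha0 i), add_sub_cancel_left, neg_smul,
      ofNat_smul_eq_nsmul]

theorem siteLower_mul_self [CharZero K] (hΨ : T.IsEvaluationHighestWeight Ψ D a)
    (ha : Function.Injective a) (ha0 : ∀ i, a i ≠ 0) {n : ℕ} (hn : T.lower 1 ^ n = 0) (i : ι) :
    T.siteLower a i * T.siteLower a i = 0 := by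
  have hnilpotent : T.siteLower a i ^ n = 0 := by
    refine pow_eq_zero_of_mul_eq_add_smul (hΨ.siteCartan_mul_lower ha i 1)
      (hΨ.siteCartan_mul_siteLower ha (ha0 i)) (T.commute_lower _ 1) ?_ hn
    simpa using ha0 i
  have hprimitive : (hΨ.isSl2Triple ha ha0 i).HasPrimitiveVectorWith Ψ ((1 : ℕ) : K) :=
    { ne_zero := hΨ.ne_zero
      lie_h := by rw [Module.End.lie_apply, hΨ.siteCartan_apply ha ha0, Nat.cast_one, one_smul]
      lie_e := hΨ.raise_apply _ }
  have hsq : (T.siteLower a i ^ 2) Ψ = 0 := by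
    simpa using pow_succ_toEnd_f_eq_zero hprimitive (n := n)
      (by rw [LieModule.toEnd_module_end, LieHom.coe_id, id, hnilpotent, LinearMap.zero_apply])
  rw [← sq]
  exact hΨ.isCyclic.eq_of_commute (fun f => (T.commute_lower _ f).pow_left 2)
    (fun _ => Commute.zero_left _) hsq

theorem siteRaise_mul_siteLower_add (hΨ : T.IsEvaluationHighestWeight Ψ D a)
    (ha : Function.Injective a) (ha0 : ∀ i, a i ≠ 0) {i : ι}
    (hsq : T.siteLower a i * T.siteLower a i = 0) :
    T.siteRaise a i * T.siteLower a i + T.siteLower a i * T.siteRaise a i = 1 := by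
  have hrl := hΨ.siteRaise_mul_siteLower ha (ha0 i)
  have hcartan := add_eq_zero_of_mul_self_eq_zero hrl hsq
  refine hΨ.isCyclic.eq_of_commute (fun f => ?_) (fun f => Commute.one_left _) ?_
  · have hcomm : Commute (T.siteLower a i) (T.lower f) := T.commute_lower _ f
    have hraise := hΨ.siteRaise_mul_lower ha i f
    rw [commute_iff_eq, add_mul, mul_add, mul_assoc, hcomm.eq, ← mul_assoc, hraise,
      mul_assoc _ _ (T.lower f), hraise, add_mul, mul_add, ← mul_assoc _ (T.lower f), hcomm.eq,
      smul_mul_assoc, mul_smul_comm]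
    linear_combination (norm := module) (a i * f.eval (a i)) • hcartan
  · rw [hrl, add_right_comm, LinearMap.add_apply, hΨ.siteCartan_apply ha ha0, LinearMap.add_apply,
      Module.End.mul_apply, siteRaise, hΨ.raise_apply, map_zero, add_zero, zero_add,
      Module.End.one_apply]

theorem isSpinHalfSystem [CharZero K] (hΨ : T.IsEvaluationHighestWeight Ψ D a)
    (ha : Function.Injective a) (ha0 : ∀ i, a i ≠ 0) {n : ℕ} (hn : T.lower 1 ^ n = 0) :
    IsSpinHalfSystem (T.siteRaise a) (T.siteLower a) where
  commute_raise i j := T.commute_raise _ _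
  commute_lower i j := T.commute_lower _ _
  commute_raise_lower i j hij := by
    rw [commute_iff_eq, siteLower, hΨ.siteRaise_mul_lower ha, eval_dualPoly ha, if_neg hij.symm,
      mul_zero, zero_smul, add_zero]
  lower_mul_self := hΨ.siteLower_mul_self ha ha0 hn
  raise_mul_lower_add i :=
    hΨ.siteRaise_mul_siteLower_add ha ha0 (hΨ.siteLower_mul_self ha ha0 hn i)

end BorelOperators.IsEvaluationHighestWeight

theorem BorelOperators.IsEvaluationHighestWeight.mem_of_stable {K V ι : Type*} [Field K]
    [CharZero K] [AddCommGroup V] [Module K V] [Fintype ι] {T : BorelOperators K V} {Ψ : V}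
    {D : K[X] →ₗ[K] K} {a : ι → K} (hΨ : T.IsEvaluationHighestWeight Ψ D a)
    (ha : Function.Injective a) (ha0 : ∀ i, a i ≠ 0) {n : ℕ} (hn : (T.lower 1 ^ n) Ψ = 0)
    {W : Submodule K V} (hW : W ≠ ⊥) (hstable : ∀ f, ∀ v ∈ W, T.raise f v ∈ W) : Ψ ∈ W := by
  classical
  have hlower : T.lower 1 ^ n = 0 := hΨ.isCyclic.eq_of_commute
    (fun f => (T.commute_lower 1 f).pow_left n) (fun _ => Commute.zero_left _) hn
  exact (hΨ.isSpinHalfSystem ha ha0 hlower).mem_of_stable (hΨ.isCyclicVector_siteLower ha ha0)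
    (fun _ => hΨ.raise_apply _) hW fun _ => hstable _

/-! ### The action of `U(B)` -/

theorem xMinus_mul_xMinus (j k : ℕ) (hj : 0 < j) (hk : 0 < k) :
    xMinus j hj * xMinus k hk = xMinus k hk * xMinus j hj := by
  apply Subtype.ext
  have hcomm := toULoop_mul_sub (loopXMinus j) (loopXMinus k)
  rw [lie_loopXMinus_loopXMinus, sub_eq_iff_eq_add'] at hcomm
  simpa [xMinus] using hcomm

theorem xPlus_mul_xPlus (j k : ℕ) : xPlus j * xPlus k = xPlus k * xPlus j := by
  apply Subtype.ext
  have hcomm := toULoop_mul_sub (loopXPlus j) (loopXPlus k)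
  rw [lie_loopXPlus_loopXPlus, sub_eq_iff_eq_add'] at hcomm
  simpa [xPlus] using hcomm

theorem h_mul_xPlus (j k : ℕ) :
    h j * xPlus k = xPlus k * h j + (2 : ℂ) • xPlus (j + k) := by
  apply Subtype.ext
  have hcomm := toULoop_mul_sub (loopH j) (loopXPlus k)
  rw [lie_loopH_loopXPlus, sub_eq_iff_eq_add', toULoop_smul] at hcomm
  simpa [xPlus, h] using hcomm

section MonomialLift

variable {K E : Type*} [CommRing K]

/-- The linear map on polynomials that sends `X ^ k` to `F k`. -/
noncomputable def monomialLift [AddCommGroup E] [Module K E] (F : ℕ → E) : K[X] →ₗ[K] E :=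
  (basisMonomials K).constr K F

theorem monomialLift_X_pow [AddCommGroup E] [Module K E] (F : ℕ → E) (k : ℕ) :
    monomialLift F (X ^ k : K[X]) = F k := by
  simpa [monomialLift, X_pow_eq_monomial] using (basisMonomials K).constr_basis K F k

theorem linearMap_mul_eq_of_X_pow [Ring E] [Algebra K E] {P Q R : K[X] →ₗ[K] E}
    (hPQ : ∀ j k, P (X ^ j) * Q (X ^ k) = Q (X ^ k) * P (X ^ j) + R (X ^ (j + k)))
    (f g : K[X]) : P f * Q g = Q g * P f + R (f * g) := by
  have hbilin : (LinearMap.mul K E).compl₁₂ P Q =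
      (LinearMap.mul K E).flip.compl₁₂ P Q + (LinearMap.mul K K[X]).compr₂ R := by
    refine (basisMonomials K).ext fun j => (basisMonomials K).ext fun k => ?_
    simpa [← X_pow_eq_monomial, ← pow_add] using hPQ j k
  exact LinearMap.congr_fun₂ hbilin f g

theorem linearMap_commute_of_X_pow [Ring E] [Algebra K E] {P : K[X] →ₗ[K] E}
    (hP : ∀ j k, Commute (P (X ^ j)) (P (X ^ k))) (f g : K[X]) : Commute (P f) (P g) := by
  simpa [commute_iff_eq] using
    linearMap_mul_eq_of_X_pow (R := 0) (fun j k => by simpa using (hP j k).eq) f g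

end MonomialLift

theorem sector_le_of_stable {V : Type*} [AddCommGroup V] [Module ℂ V] [Module borel V] {Ψ : V}
    {N : Submodule ℂ V} (hΨN : Ψ ∈ N) (hN : ∀ k (hk : 0 < k), ∀ v ∈ N, xMinus k hk • v ∈ N)
    (n : ℕ) : sector Ψ n ≤ N := by
  induction n with
  | zero => exact (Submodule.span_singleton_le_iff_mem Ψ N).mpr hΨN
  | succ n ih =>
    refine Submodule.span_le.mpr ?_
    rintro _ ⟨k, hk, v, hv, rfl⟩
    exact hN k hk v (ih hv)

section Representation

variable {V : Type*} [AddCommGroup V] [Module ℂ V] [Module borel V] [IsScalarTower ℂ borel V]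

variable (V) in
/-- The operators on `V` given by the elements of `U(B)`. -/
noncomputable def action : borel →ₐ[ℂ] Module.End ℂ V :=
  haveI : SMulCommClass borel ℂ V := ⟨smul_comm_complex⟩
  Algebra.lsmul ℂ ℂ V

theorem action_apply (b : borel) (v : V) : action V b v = b • v := rfl

variable (V) in
/-- The operators `x_k⁺`, `h_k` and `x_{k+1}⁻` of `U(B)` on `V`, corresponding to the polynomial
`X ^ k`. -/
noncomputable def borelOperators : BorelOperators ℂ V where
  raise := monomialLift fun k => action V (xPlus k)
  cartan := monomialLift fun k => action V (h k)
  lower := monomialLift fun k => action V (xMinus (k + 1) k.succ_pos)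
  raise_mul_lower := by
    refine linearMap_mul_eq_of_X_pow
      (R := monomialLift (fun k => action V (h k)) ∘ₗ LinearMap.mulLeft ℂ X) fun j k => ?_
    simp only [LinearMap.comp_apply, LinearMap.mulLeft_apply, ← pow_succ', monomialLift_X_pow,
      ← map_mul, xPlus_mul_xMinus, map_add, Nat.add_assoc]
  cartan_mul_lower f g := by
    rw [← LinearMap.smul_apply]
    refine linearMap_mul_eq_of_X_pow (fun j k => ?_) f g
    simp only [LinearMap.smul_apply, monomialLift_X_pow, ← map_mul, h_mul_xMinus, map_add,
      map_smul, Nat.add_assoc]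
  cartan_mul_raise f g := by
    rw [← LinearMap.smul_apply]
    refine linearMap_mul_eq_of_X_pow (fun j k => ?_) f g
    simp only [LinearMap.smul_apply, monomialLift_X_pow, ← map_mul, h_mul_xPlus, map_add, map_smul]
  commute_raise := linearMap_commute_of_X_pow fun j k => by
    simp only [monomialLift_X_pow]
    exact Commute.map (xPlus_mul_xPlus j k) _
  commute_lower := linearMap_commute_of_X_pow fun j k => by
    simp only [monomialLift_X_pow]
    exact Commute.map (xMinus_mul_xMinus _ _ _ _) _

theorem borelOperators_raise_X_pow (k : ℕ) :
    (borelOperators V).raise (X ^ k) = action V (xPlus k) :=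
  monomialLift_X_pow _ k

theorem borelOperators_cartan_X_pow (k : ℕ) :
    (borelOperators V).cartan (X ^ k) = action V (h k) :=
  monomialLift_X_pow _ k

theorem borelOperators_lower_X_pow (k : ℕ) :
    (borelOperators V).lower (X ^ k) = action V (xMinus (k + 1) k.succ_pos) :=
  monomialLift_X_pow _ k

theorem borelOperators_raise_one_pow_apply (n : ℕ) (v : V) :
    ((borelOperators V).raise 1 ^ n) v = xPlus 0 ^ n • v := by
  rw [← pow_zero X, borelOperators_raise_X_pow, ← map_pow, action_apply]

theorem borelOperators_lower_one_pow_apply (n : ℕ) (v : V) :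
    ((borelOperators V).lower 1 ^ n) v = xMinus 1 one_pos ^ n • v := by
  rw [← pow_zero X, borelOperators_lower_X_pow, ← map_pow, action_apply]

theorem borelOperators_raise_mem (W : Submodule borel V) (f : ℂ[X]) {v : V} (hv : v ∈ W) :
    (borelOperators V).raise f v ∈ W := by
  induction f using Polynomial.induction_on' with
  | add p q hp hq => exact map_add (borelOperators V).raise p q ▸ add_mem hp hq
  | monomial k c =>
    rw [← C_mul_X_pow_eq_monomial, ← smul_eq_C_mul, map_smul, borelOperators_raise_X_pow]
    exact (W.restrictScalars ℂ).smul_mem c (W.smul_mem (xPlus k) hv)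

theorem borel_smul_mem {N : Submodule ℂ V} (hh : ∀ v ∈ N, h 0 • v ∈ N)
    (hp : ∀ v ∈ N, xPlus 0 • v ∈ N) (hm : ∀ v ∈ N, xMinus 1 one_pos • v ∈ N) (b : borel) :
    ∀ v ∈ N, b • v ∈ N := by
  have hb : b ∈ Algebra.adjoin ℂ ((↑) ⁻¹' {toULoop (loopH 0), toULoop (loopXPlus 0),
      toULoop (loopXMinus 1)} : Set borel) :=
    Algebra.adjoin_adjoin_coe_preimage.ge Algebra.mem_top
  induction hb using Algebra.adjoin_induction with
  | mem b hb =>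
    rcases hb with hb | hb | hb
    · exact (Subtype.ext hb : b = h 0) ▸ hh
    · exact (Subtype.ext hb : b = xPlus 0) ▸ hp
    · exact (Subtype.ext hb : b = xMinus 1 one_pos) ▸ hm
  | algebraMap c =>
    intro v hv
    rw [algebraMap_smul]
    exact N.smul_mem c hv
  | add b c _ _ hb hc => exact fun v hv => add_smul b c v ▸ N.add_mem (hb v hv) (hc v hv)
  | mul b c _ _ hb hc => exact fun v hv => mul_smul b c v ▸ hb _ (hc v hv)

namespace IsHighestWeightVector

variable {Ψ : V} {d : ℕ → ℂ}

theorem iSup_sector_eq_top (hΨ : IsHighestWeightVector Ψ d)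
    (hgen : Submodule.span borel {Ψ} = ⊤) : ⨆ n, sector Ψ n = ⊤ := by
  have hstable (b : borel) (hb : ∀ n, ∀ v ∈ sector Ψ n, b • v ∈ ⨆ n, sector Ψ n) :
      ∀ v ∈ ⨆ n, sector Ψ n, b • v ∈ ⨆ n, sector Ψ n :=
    iSup_le (a := (⨆ n, sector Ψ n).comap (action V b)) hb
  have hborel := borel_smul_mem (N := ⨆ n, sector Ψ n)
    (hstable _ fun n v hv => Submodule.mem_iSup_of_mem n (hΨ.h_smul_mem_sector n 0 hv))
    (hstable _ fun n v hv => by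
      cases n with
      | zero =>
        obtain ⟨c, rfl⟩ := Submodule.mem_span_singleton.mp hv
        rw [smul_comm_complex, hΨ.xPlus_smul, smul_zero]
        exact zero_mem _
      | succ n => exact Submodule.mem_iSup_of_mem n (hΨ.xPlus_smul_mem_sector n 0 hv))
    (hstable _ fun n v hv =>
      Submodule.mem_iSup_of_mem (n + 1) (xMinus_smul_mem_sector Ψ n 1 one_pos hv))
  refine eq_top_iff.mpr fun v _ => ?_
  obtain ⟨b, rfl⟩ := Submodule.mem_span_singleton.mp (hgen ▸ Submodule.mem_top : v ∈ _)
  exact hborel b Ψ (Submodule.mem_iSup_of_mem 0 (Submodule.mem_span_singleton_self Ψ))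

theorem isCyclicHighestWeight (hΨ : IsHighestWeightVector Ψ d)
    (hgen : Submodule.span borel {Ψ} = ⊤) :
    (borelOperators V).IsCyclicHighestWeight Ψ (monomialLift d) where
  ne_zero := hΨ.ne_zero
  raise_apply := by
    have hraise : (borelOperators V).raise.flip Ψ = 0 := (basisMonomials ℂ).ext fun k => by
      simp [← X_pow_eq_monomial, borelOperators_raise_X_pow, action_apply, hΨ.xPlus_smul]
    exact LinearMap.congr_fun hraise
  cartan_apply := by
    have hcartan : (borelOperators V).cartan.flip Ψ = (monomialLift d).smulRight Ψ :=
      (basisMonomials ℂ).ext fun k => by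
        simp [← X_pow_eq_monomial, borelOperators_cartan_X_pow, action_apply, hΨ.h_smul,
          monomialLift_X_pow]
    exact LinearMap.congr_fun hcartan
  isCyclic N hΨN hN := by
    rw [eq_top_iff, ← hΨ.iSup_sector_eq_top hgen]
    refine iSup_le (sector_le_of_stable hΨN fun k hk v hv => ?_)
    obtain ⟨k, rfl⟩ := Nat.exists_eq_succ_of_ne_zero hk.ne'
    simpa [borelOperators_lower_X_pow, action_apply] using hN (X ^ k) v hv

theorem raise_pow_lower_pow_apply (hΨ : IsHighestWeightVector Ψ d) (n : ℕ) :
    ((borelOperators V).raise 1 ^ n) (((borelOperators V).lower 1 ^ n) Ψ) =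
      ((n ! : ℂ) ^ 2 * lam Ψ n) • Ψ := by
  have hn : (n ! : ℂ) ≠ 0 := by exact_mod_cast n.factorial_ne_zero
  rw [borelOperators_lower_one_pow_apply, borelOperators_raise_one_pow_apply, mul_smul,
    ← hΨ.lam_spec, divPow, divPow, mul_smul, smul_assoc, smul_assoc, smul_comm_complex, sq,
    mul_smul (n ! : ℂ), smul_inv_smul₀ hn, smul_inv_smul₀ hn]

theorem lam_eq_zero_of_lt (hΨ : IsHighestWeightVector Ψ d) {r k : ℕ}
    (hr : xMinus 1 one_pos ^ (r + 1) • Ψ = 0) (hk : r < k) : lam Ψ k = 0 := by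
  have hlower : divPow (xMinus 1 one_pos) k • Ψ = 0 := by
    rw [divPow, smul_assoc, ← Nat.sub_add_cancel hk, pow_add, mul_smul, hr, smul_zero, smul_zero]
  rw [hΨ.lam_eq_iff, mul_smul, hlower, smul_zero, zero_smul]

theorem lam_eq_coeff_prod (hΨ : IsHighestWeightVector Ψ d) {r : ℕ}
    (hr : xMinus 1 one_pos ^ (r + 1) • Ψ = 0) {a : Fin r → ℂ} (ha : HasEvaluationParameters Ψ r a) :
    lam Ψ = (∏ i, (1 + C (a i) * X)).coeff := by
  have hdrinfeld : ∑ k ∈ Finset.range (r + 1), C (lam Ψ k) * X ^ k = ∏ i, (1 + C (a i) * X) := by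
    simpa [drinfeldPoly, Polynomial.prod_comp] using congrArg (fun p => p.comp (-X)) ha
  ext k
  rw [← hdrinfeld, finsetSum_coeff]
  simp only [coeff_C_mul_X_pow, Finset.sum_ite_eq, Finset.mem_range]
  split_ifs with hk
  · rfl
  · exact hΨ.lam_eq_zero_of_lt hr (by omega)

end IsHighestWeightVector

end Representation

end SlTwoLoop

theorem mainTheorem1_general {V : Type*} [AddCommGroup V] [Module ℂ V] [Module SlTwoLoop.borel V]
    [IsScalarTower ℂ SlTwoLoop.borel V]
    (Ψ : V) (d : ℕ → ℂ) (hΨ : SlTwoLoop.IsHighestWeightVector Ψ d)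
    (hgen : Submodule.span SlTwoLoop.borel {Ψ} = ⊤)
    (r : ℕ) (hr : SlTwoLoop.xMinus 1 one_pos ^ (r + 1) • Ψ = 0)
    (a : Fin r → ℂ) (ha : SlTwoLoop.HasEvaluationParameters Ψ r a)
    (hdistinct : Function.Injective a) (hnonzero : ∀ i, a i ≠ 0) :
    IsSimpleModule SlTwoLoop.borel V := by
  have hlower : ((SlTwoLoop.borelOperators V).lower 1 ^ (r + 1)) Ψ = 0 := by
    rw [SlTwoLoop.borelOperators_lower_one_pow_apply, hr]
  have heval : (SlTwoLoop.borelOperators V).IsEvaluationHighestWeight Ψ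
      (SlTwoLoop.monomialLift d) a :=
    (hΨ.isCyclicHighestWeight hgen).isEvaluationHighestWeight hdistinct
      (fun n => by rw [hΨ.raise_pow_lower_pow_apply, hΨ.lam_eq_coeff_prod hr ha])
      (by rw [Fintype.card_fin, hlower])
  have hnontrivial : Nontrivial V := ⟨⟨Ψ, 0, hΨ.ne_zero⟩⟩
  refine (isSimpleModule_iff _ _).mpr ⟨fun W => or_iff_not_imp_left.mpr fun hW => ?_⟩
  rw [eq_top_iff, ← hgen, Submodule.span_singleton_le_iff_mem]
  exact heval.mem_of_stable hdistinct hnonzero hlower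
    (W := W.restrictScalars ℂ) (by rwa [Ne, Submodule.restrictScalars_eq_bot_iff])
    fun f _ hv => SlTwoLoop.borelOperators_raise_mem W f hv

theorem mainTheorem1 {V : Type*} [AddCommGroup V] [Module ℂ V] [Module SlTwoLoop.borel V]
    [IsScalarTower ℂ SlTwoLoop.borel V] [FiniteDimensional ℂ V]
    (Ψ : V) (d : ℕ → ℂ) (hΨ : SlTwoLoop.IsHighestWeightVector Ψ d)
    (hgen : Submodule.span SlTwoLoop.borel {Ψ} = ⊤)
    (r : ℕ) (hr : SlTwoLoop.NilpotentOfDegree Ψ r)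
    (a : Fin r → ℂ) (ha : SlTwoLoop.HasEvaluationParameters Ψ r a)
    (hdistinct : Function.Injective a) (hnonzero : ∀ i, a i ≠ 0) :
    IsSimpleModule SlTwoLoop.borel V :=
  mainTheorem1_general Ψ d hΨ hgen r hr.1 a ha hdistinct hnonzero
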